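/- A bipartite ordered graph is a finite bipartite graph with two distinguished parts (a left part and a right part, either of which may be empty), together with a linear order on each part. Such graphs are considered up to isomorphisms that preserve the two parts and their orders, so a bipartite ordered graph whose left part has $p$ vertices and whose right part has $q$ vertices is the same thing as a $p \times q$ matrix with entries in $\{0,1\}$. We say that $H$ is an induced ordered subgraph of $G$ if there is an injective map from the vertices of $H$ to the vertices of $G$ that sends left part to left part and right part to right part, preserves the order on each part, and preserves both adjacency and non-adjacency. A collection $\mathcal{P}$ of bipartite ordered graphs is a hereditary property if it is closed under isomorphisms and under taking induced ordered subgraphs. For $n \geq 1$ let $\mathcal{P}_n$ be the set of members of $\mathcal{P}$ (up to isomorphism) with exactly $n$ vertices in total, i.e. with $p + q = n$. Corollary. Let $\mathcal{P}$ be a hereditary property of bipartite ordered graphs. Then either (a) there exist $k \in \mathbb{N}$ and integers $a_0, \ldots, a_k$ such that $|\mathcal{P}_n| = \sum_{i=0}^{k} a_i \binom{n}{i}$ for all sufficiently large $n$, or (b) $|\mathcal{P}_n| \geq 2^{n-1}$ for every integer $n \geq 1$. -/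

import Mathlib

/-- A (finite) bipartite ordered graph: a bipartite graph with two distinguished parts, each of them
linearly ordered. By convention the left part is `Fin left` and the right part is `Fin right`, with
their usual orders, so that order-preserving isomorphism is equality (there is exactly one such
object for each `{0,1}`-matrix with `left` rows and `right` columns; either part may be empty). -/
@[ext]
structure BipartiteOrderedGraph where
  left : ℕ
  right : ℕ
  graph : SimpleGraph (Fin left ⊕ Fin right)
  isBipartiteWith : graph.IsBipartiteWith (Set.range Sum.inl) (Set.range Sum.inr)

namespace BipartiteOrderedGraph

/-- The number of vertices. -/
def order (G : BipartiteOrderedGraph) : ℕ := G.left + G.right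

/-- `H` is an induced ordered subgraph of `G`: there are strictly increasing maps from the left part
of `H` to the left part of `G` and from the right part of `H` to the right part of `G` which
together preserve adjacency and non-adjacency. -/
def IsInducedSubgraph (H G : BipartiteOrderedGraph) : Prop :=
  ∃ (φ : Fin H.left ↪o Fin G.left) (ψ : Fin H.right ↪o Fin G.right),
    ∀ u v, H.graph.Adj u v ↔ G.graph.Adj (Sum.map φ ψ u) (Sum.map φ ψ v)

/-- A collection of bipartite ordered graphs is hereditary if it is closed under taking induced
ordered subgraphs. -/
def IsHereditary (P : Set BipartiteOrderedGraph) : Prop :=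
  ∀ G ∈ P, ∀ H : BipartiteOrderedGraph, H.IsInducedSubgraph G → H ∈ P

/-- The members of `P` with exactly `n` vertices. -/
def ofOrder (P : Set BipartiteOrderedGraph) (n : ℕ) : Set BipartiteOrderedGraph :=
  {G | G ∈ P ∧ G.order = n}

/-- There are only finitely many bipartite ordered graphs with `n` vertices, so that the cardinality
in `speed` below is an honest one. -/
theorem finite_ofOrder (P : Set BipartiteOrderedGraph) (n : ℕ) : (ofOrder P n).Finite := by
  let f : ofOrder P n →
      Σ p : Fin (n + 1), Σ q : Fin (n + 1), SimpleGraph (Fin (p : ℕ) ⊕ Fin (q : ℕ)) := fun G =>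
    ⟨⟨G.1.left, by have h := G.2.2; unfold order at h; omega⟩,
      ⟨G.1.right, by have h := G.2.2; unfold order at h; omega⟩, G.1.graph⟩
  have hf : Function.Injective f := by
    rintro ⟨⟨p, q, g, hg⟩, h⟩ ⟨⟨p', q', g', hg'⟩, h'⟩ e
    simp only [f, Sigma.mk.injEq, Fin.mk.injEq] at e
    obtain ⟨rfl, e⟩ := e
    simp only [heq_eq_eq, Sigma.mk.injEq, Fin.mk.injEq] at e
    obtain ⟨rfl, e⟩ := e
    simp only [heq_eq_eq] at e
    subst e
    rfl
  have : Finite (ofOrder P n) := Finite.of_injective f hf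
  exact Set.toFinite _

/-- The speed `n ↦ |Pₙ|` of a collection of bipartite ordered graphs. -/
noncomputable def speed (P : Set BipartiteOrderedGraph) (n : ℕ) : ℕ := (ofOrder P n).ncard

end BipartiteOrderedGraph

/-! View a graph as a 0/1 matrix and count its row changes, the places where consecutive rows
differ, and likewise its column changes. The dichotomy is whether both counts are bounded on `P`.

If the number of row changes is unbounded, attach to each change a column witnessing it and apply
Ramsey's theorem. By `exists_hasUnavoidable`, `P` then contains either every one-column matrix, or,
up to reversing the columns, arbitrarily large square matrices that are constant above, on and below
the diagonal, with the diagonal differing from the part above. One-column matrices give `2 ^ (n -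
1)` graphs; each diagonal pattern gives `2 ^ n`, by coding subsets of `range n` as submatrices.
Column changes follow by transposition.

If both counts are bounded by `K`, a member of `P` is determined by its block sizes and the matrix
of values on blocks, its `type`, of which there are finitely many. Shrinking blocks without emptying
them stays in `P` and keeps the type, so the size vectors of each type form a `SupportLower` set.
Dickson's lemma shows that such a set has finitely many distinct slices, and induction on the
dimension makes its count by coordinate sum eventually an integer combination of binomial
coefficients. -/

namespace BipartiteOrderedGraph

/-! ### Matrix encoding and symmetries. -/

open Classical in
/-- The biadjacency matrix of `G`, extended by `false` outside the index range. -/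
noncomputable def mat (G : BipartiteOrderedGraph) (i j : ℕ) : Bool :=
  decide (∃ (hi : i < G.left) (hj : j < G.right),
    G.graph.Adj (Sum.inl ⟨i, hi⟩) (Sum.inr ⟨j, hj⟩))

/-- The bipartite ordered graph with a given biadjacency matrix. -/
def ofMat (p q : ℕ) (M : ℕ → ℕ → Bool) : BipartiteOrderedGraph where
  left := p
  right := q
  graph :=
    { Adj := fun u v => match u, v with
        | Sum.inl i, Sum.inr j => M i j = true
        | Sum.inr j, Sum.inl i => M i j = true
        | _, _ => False
      symm := ⟨by rintro (i | i) (j | j) h <;> exact h⟩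
      loopless := ⟨by rintro (i | i) h <;> exact h⟩ }
  isBipartiteWith :=
    { disjoint := by
        rw [Set.disjoint_left]
        rintro _ ⟨i, rfl⟩ ⟨j, h⟩
        cases h
      mem_of_adj := by
        rintro (i | i) (j | j) h
        · exact h.elim
        · exact Or.inl ⟨⟨i, rfl⟩, ⟨j, rfl⟩⟩
        · exact Or.inr ⟨⟨i, rfl⟩, ⟨j, rfl⟩⟩
        · exact h.elim }

@[simp] theorem left_ofMat (p q : ℕ) (M : ℕ → ℕ → Bool) : (ofMat p q M).left = p := rfl

@[simp] theorem right_ofMat (p q : ℕ) (M : ℕ → ℕ → Bool) : (ofMat p q M).right = q := rfl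

@[simp] theorem order_ofMat (p q : ℕ) (M : ℕ → ℕ → Bool) : (ofMat p q M).order = p + q := rfl

theorem mat_ofMat {p q : ℕ} (M : ℕ → ℕ → Bool) {i j : ℕ} (hi : i < p) (hj : j < q) :
    (ofMat p q M).mat i j = M i j := by
  have : (ofMat p q M).mat i j = true ↔ M i j = true := by
    simp only [mat, decide_eq_true_eq]
    exact ⟨fun ⟨_, _, h⟩ => h, fun h => ⟨hi, hj, h⟩⟩
  rwa [Bool.eq_iff_iff]

theorem not_adj_inl_inl (G : BipartiteOrderedGraph) (i j : Fin G.left) :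
    ¬ G.graph.Adj (Sum.inl i) (Sum.inl j) := fun h => by
  rcases G.isBipartiteWith.mem_of_adj h with ⟨-, ⟨k, hk⟩⟩ | ⟨⟨k, hk⟩, -⟩ <;> cases hk

theorem not_adj_inr_inr (G : BipartiteOrderedGraph) (i j : Fin G.right) :
    ¬ G.graph.Adj (Sum.inr i) (Sum.inr j) := fun h => by
  rcases G.isBipartiteWith.mem_of_adj h with ⟨⟨k, hk⟩, -⟩ | ⟨-, ⟨k, hk⟩⟩ <;> cases hk

theorem adj_iff_mat (G : BipartiteOrderedGraph) (i : Fin G.left) (j : Fin G.right) :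
    G.graph.Adj (Sum.inl i) (Sum.inr j) ↔ G.mat i j = true := by
  simp [mat]

theorem ext_mat {G H : BipartiteOrderedGraph} (hl : G.left = H.left) (hr : G.right = H.right)
    (h : ∀ i < G.left, ∀ j < G.right, G.mat i j = H.mat i j) : G = H := by
  obtain ⟨p, q, g, hg⟩ := G
  obtain ⟨p', q', g', hg'⟩ := H
  obtain rfl : p = p' := hl
  obtain rfl : q = q' := hr
  obtain rfl : g = g' := by
    have key : ∀ i j, g.Adj (Sum.inl i) (Sum.inr j) ↔ g'.Adj (Sum.inl i) (Sum.inr j) := by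
      intro i j
      have := h i i.2 j j.2
      rw [Bool.eq_iff_iff, ← adj_iff_mat, ← adj_iff_mat] at this
      exact this
    ext u v
    rcases u with i | i <;> rcases v with j | j
    · exact iff_of_false (not_adj_inl_inl ⟨p, q, g, hg⟩ i j) (not_adj_inl_inl ⟨p, q, g', hg'⟩ i j)
    · exact key i j
    · rw [g.adj_comm, g'.adj_comm]; exact key j i
    · exact iff_of_false (not_adj_inr_inr ⟨p, q, g, hg⟩ i j) (not_adj_inr_inr ⟨p, q, g', hg'⟩ i j)
  rfl

theorem ofMat_congr {p q : ℕ} {M N : ℕ → ℕ → Bool} (h : ∀ i < p, ∀ j < q, M i j = N i j) :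
    ofMat p q M = ofMat p q N :=
  ext_mat rfl rfl fun i (hi : i < p) j (hj : j < q) => by
    rw [mat_ofMat _ hi hj, mat_ofMat _ hi hj, h i hi j hj]

/-- Closure under taking submatrices. -/
def SubClosed (P : Set BipartiteOrderedGraph) : Prop :=
  ∀ G ∈ P, ∀ (p q : ℕ) (φ ψ : ℕ → ℕ), StrictMonoOn φ (Set.Iio p) → StrictMonoOn ψ (Set.Iio q) →
    (∀ i < p, φ i < G.left) → (∀ j < q, ψ j < G.right) →
    ofMat p q (fun i j => G.mat (φ i) (ψ j)) ∈ P

theorem IsHereditary.subClosed {P : Set BipartiteOrderedGraph} (hP : IsHereditary P) :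
    SubClosed P := by
  intro G hG p q φ ψ hφ hψ hφ' hψ'
  refine hP G hG _ ⟨OrderEmbedding.ofStrictMono (fun i : Fin p => ⟨φ i, hφ' i i.2⟩)
    fun i j hij => hφ i.2 j.2 hij, OrderEmbedding.ofStrictMono
    (fun i : Fin q => ⟨ψ i, hψ' i i.2⟩) fun i j hij => hψ i.2 j.2 hij, ?_⟩
  have key : ∀ (i : Fin p) (j : Fin q), G.mat (φ i) (ψ j) = true ↔
      G.graph.Adj (Sum.inl ⟨φ i, hφ' i i.2⟩) (Sum.inr ⟨ψ j, hψ' j j.2⟩) :=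
    fun i j => (adj_iff_mat G ⟨φ i, hφ' i i.2⟩ ⟨ψ j, hψ' j j.2⟩).symm
  rintro (i | i) (j | j)
  · exact iff_of_false (fun h => h) (not_adj_inl_inl G _ _)
  · exact key i j
  · rw [SimpleGraph.adj_comm, G.graph.adj_comm]; exact key j i
  · exact iff_of_false (fun h => h) (not_adj_inr_inr G _ _)

theorem SubClosed.mem_of_eq {P : Set BipartiteOrderedGraph} (hP : SubClosed P)
    {G : BipartiteOrderedGraph} (hG : G ∈ P) {p q : ℕ} {M : ℕ → ℕ → Bool} {φ ψ : ℕ → ℕ}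
    (hφ : StrictMonoOn φ (Set.Iio p)) (hψ : StrictMonoOn ψ (Set.Iio q))
    (hφ' : ∀ i < p, φ i < G.left) (hψ' : ∀ j < q, ψ j < G.right)
    (h : ∀ i < p, ∀ j < q, M i j = G.mat (φ i) (ψ j)) : ofMat p q M ∈ P := by
  rw [ofMat_congr h]
  exact hP G hG p q φ ψ hφ hψ hφ' hψ'

/-- Interchange the two parts. -/
noncomputable def transpose (G : BipartiteOrderedGraph) : BipartiteOrderedGraph :=
  ofMat G.right G.left fun i j => G.mat j i

@[simp] theorem left_transpose (G : BipartiteOrderedGraph) : G.transpose.left = G.right := rfl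

@[simp] theorem right_transpose (G : BipartiteOrderedGraph) : G.transpose.right = G.left := rfl

theorem mat_transpose (G : BipartiteOrderedGraph) {i j : ℕ} (hi : i < G.right) (hj : j < G.left) :
    G.transpose.mat i j = G.mat j i := mat_ofMat _ hi hj

theorem transpose_transpose (G : BipartiteOrderedGraph) : G.transpose.transpose = G :=
  ext_mat rfl rfl fun i (hi : i < G.left) j (hj : j < G.right) => by
    rw [mat_transpose G.transpose hi hj, mat_transpose _ hj hi]

/-- Reverse the order of the right part. -/
noncomputable def reverse (G : BipartiteOrderedGraph) : BipartiteOrderedGraph :=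
  ofMat G.left G.right fun i j => G.mat i (G.right - 1 - j)

@[simp] theorem left_reverse (G : BipartiteOrderedGraph) : G.reverse.left = G.left := rfl

@[simp] theorem right_reverse (G : BipartiteOrderedGraph) : G.reverse.right = G.right := rfl

theorem mat_reverse (G : BipartiteOrderedGraph) {i j : ℕ} (hi : i < G.left) (hj : j < G.right) :
    G.reverse.mat i j = G.mat i (G.right - 1 - j) := mat_ofMat _ hi hj

theorem reverse_reverse (G : BipartiteOrderedGraph) : G.reverse.reverse = G :=
  ext_mat rfl rfl fun i (hi : i < G.left) j (hj : j < G.right) => by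
    rw [mat_reverse G.reverse hi hj, mat_reverse _ hi (by simp; omega)]
    simp only [right_reverse]
    congr 1
    omega

theorem speed_preimage {P : Set BipartiteOrderedGraph}
    {f : BipartiteOrderedGraph → BipartiteOrderedGraph} (hf : ∀ G, f (f G) = G)
    (ho : ∀ G, (f G).order = G.order) (n : ℕ) : speed (f ⁻¹' P) n = speed P n := by
  have hinj : Function.Injective f := fun a b h => by rw [← hf a, h, hf]
  have : ofOrder (f ⁻¹' P) n = f '' ofOrder P n := by
    ext G
    constructor
    · rintro ⟨h1, h2⟩
      exact ⟨f G, ⟨h1, by rw [ho, h2]⟩, hf G⟩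
    · rintro ⟨H, ⟨h1, h2⟩, rfl⟩
      exact ⟨by simpa [hf] using h1, by rw [ho, h2]⟩
  rw [speed, this, Set.ncard_image_of_injective _ hinj, speed]

theorem speed_transpose (P : Set BipartiteOrderedGraph) (n : ℕ) :
    speed (transpose ⁻¹' P) n = speed P n :=
  speed_preimage transpose_transpose (fun G => by simp [order, add_comm]) n

theorem speed_reverse (P : Set BipartiteOrderedGraph) (n : ℕ) :
    speed (reverse ⁻¹' P) n = speed P n :=
  speed_preimage reverse_reverse (fun G => by simp [order]) n

theorem SubClosed.transpose {P : Set BipartiteOrderedGraph} (hP : SubClosed P) :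
    SubClosed (transpose ⁻¹' P) := by
  intro G hG p q φ ψ hφ hψ hφ' hψ'
  refine hP.mem_of_eq hG (φ := ψ) (ψ := φ) hψ hφ hψ' hφ' fun i (hi : i < q) j (hj : j < p) => ?_
  rw [mat_ofMat _ hj hi, mat_transpose _ (hψ' i hi) (hφ' j hj)]

theorem SubClosed.reverse {P : Set BipartiteOrderedGraph} (hP : SubClosed P) :
    SubClosed (reverse ⁻¹' P) := by
  intro G hG p q φ ψ hφ hψ hφ' hψ'
  -- Conjugating `ψ` by the two reversals gives an increasing map again.
  refine hP.mem_of_eq hG (φ := φ) (ψ := fun j => G.right - 1 - ψ (q - 1 - j)) hφ ?_ hφ' ?_ ?_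
  · intro i (hi : i < q) j (hj : j < q) hij
    have h1 := hψ (show q - 1 - j ∈ Set.Iio q by simp; omega)
      (show q - 1 - i ∈ Set.Iio q by simp; omega) (show q - 1 - j < q - 1 - i by omega)
    have h2 := hψ' (q - 1 - i) (by omega)
    simp only
    omega
  · intro j (hj : j < q)
    have h2 := hψ' (q - 1 - j) (by omega)
    simp only [right_reverse]
    omega
  · intro i (hi : i < p) j (hj : j < q)
    have h2 := hψ' (q - 1 - j) (by omega)
    rw [mat_reverse _ (hφ' i hi) (by omega), right_ofMat, mat_ofMat _ hi (by omega)]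
    congr 1
    omega

theorem le_speed_of_injective {α : Type*} [Fintype α] {P : Set BipartiteOrderedGraph} {n : ℕ}
    (f : α → BipartiteOrderedGraph) (hf : Function.Injective f) (hP : ∀ a, f a ∈ P)
    (ho : ∀ a, (f a).order = n) : Fintype.card α ≤ speed P n := by
  rw [speed, ← Nat.card_eq_fintype_card, ← Set.ncard_univ, ← Set.ncard_image_of_injective _ hf]
  refine Set.ncard_le_ncard ?_ (finite_ofOrder P n)
  rintro _ ⟨a, -, rfl⟩
  exact ⟨hP a, ho a⟩

end BipartiteOrderedGraph

/-! ### Enumeration of finite sets. -/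

/-- The increasing enumeration of a finite set of natural numbers. -/
noncomputable def enum (U : Finset ℕ) : ℕ → ℕ := Nat.nth (· ∈ U)

theorem card_finite_toFinset (U : Finset ℕ) (hf : (Set.ofPred (· ∈ U)).Finite) :
    hf.toFinset.card = U.card := by
  congr 1
  ext
  simp

theorem enum_mem {U : Finset ℕ} {i : ℕ} (hi : i < U.card) : enum U i ∈ U :=
  Nat.nth_mem (p := (· ∈ U)) i fun hf => by rwa [card_finite_toFinset]

theorem enum_strictMonoOn (U : Finset ℕ) : StrictMonoOn (enum U) (Set.Iio U.card) := by
  have hf : (Set.ofPred (· ∈ U)).Finite := U.finite_toSet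
  have := Nat.nth_strictMonoOn hf
  rwa [card_finite_toFinset] at this

theorem enum_count {U : Finset ℕ} {x : ℕ} (hx : x ∈ U) : enum U (Nat.count (· ∈ U) x) = x :=
  Nat.nth_count (p := (· ∈ U)) hx

theorem count_lt_card {U : Finset ℕ} {x : ℕ} (hx : x ∈ U) : Nat.count (· ∈ U) x < U.card := by
  have hf : (Set.ofPred (· ∈ U)).Finite := U.finite_toSet
  rw [← card_finite_toFinset U hf]
  exact Nat.count_lt_card hf hx

theorem le_enum_count {U : Finset ℕ} {x : ℕ} (h : Nat.count (· ∈ U) x < U.card) :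
    x ≤ enum U (Nat.count (· ∈ U) x) := by
  refine Nat.le_nth_count' (p := (· ∈ U)) ?_
  by_contra! hk
  refine h.not_ge ?_
  rw [Nat.count_eq_card_filter_range]
  exact Finset.card_le_card fun k hk' => by
    simp only [Finset.mem_filter, Finset.mem_range]
    exact ⟨hk k hk', hk'⟩

theorem image_enum (U : Finset ℕ) : (Finset.range U.card).image (enum U) = U := by
  ext x
  simp only [Finset.mem_image, Finset.mem_range]
  constructor
  · rintro ⟨i, hi, rfl⟩
    exact enum_mem hi
  · exact fun hx => ⟨_, count_lt_card hx, enum_count hx⟩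

/-! ### Ramsey's theorem for pairs. -/

/-- Keep the least element `x` of `S`, pass to a largest class of the remaining `y` under `c x y`,
and iterate inside it; the colour of a pair then depends only on its smaller element. -/
theorem exists_endHomogeneous {C : Type*} [Finite C] [Nonempty C] (L : ℕ) :
    ∃ N : ℕ, ∀ (c : ℕ → ℕ → C) (S : Finset ℕ), N ≤ S.card →
      ∃ T ⊆ S, T.card = L ∧ ∃ d : ℕ → C, ∀ x ∈ T, ∀ y ∈ T, x < y → c x y = d x := by
  classical
  cases nonempty_fintype C
  induction L with
  | zero =>
    exact ⟨0, fun c S _ => ⟨∅, by simp, rfl, fun _ => Classical.arbitrary C, by simp⟩⟩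
  | succ L ih =>
    obtain ⟨N, hN⟩ := ih
    refine ⟨Fintype.card C * N + 1, fun c S hS => ?_⟩
    have hne : S.Nonempty := Finset.card_pos.mp (by omega)
    set x := S.min' hne with hx
    have hxS : x ∈ S := S.min'_mem hne
    obtain ⟨col, -, hcol⟩ := Finset.exists_le_card_fiber_of_mul_le_card_of_maps_to
      (s := S.erase x) (t := (Finset.univ : Finset C)) (f := fun y => c x y) (n := N)
      (fun _ _ => Finset.mem_univ _) Finset.univ_nonempty
      (by rw [Finset.card_erase_of_mem hxS, Finset.card_univ]; omega)
    obtain ⟨T, hTS, hT, d, hd⟩ := hN c _ hcol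
    have hT' : ∀ y ∈ T, (y ≠ x ∧ y ∈ S) ∧ c x y = col := fun y hy => by
      simpa using hTS hy
    have hxT : x ∉ T := fun h => (hT' x h).1.1 rfl
    have hlt : ∀ y ∈ T, x < y := fun y hy =>
      lt_of_le_of_ne (S.min'_le y (hT' y hy).1.2) (hT' y hy).1.1.symm
    refine ⟨insert x T, ?_, by rw [Finset.card_insert_of_notMem hxT, hT],
      Function.update d x col, ?_⟩
    · intro y hy
      rcases Finset.mem_insert.mp hy with rfl | hy
      exacts [hxS, (hT' y hy).1.2]
    · intro y hy z hz hyz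
      rcases Finset.mem_insert.mp hy with rfl | hy
      · rcases Finset.mem_insert.mp hz with rfl | hz
        · exact absurd hyz (lt_irrefl _)
        · rw [Function.update_self]
          exact (hT' z hz).2
      · rcases Finset.mem_insert.mp hz with rfl | hz
        · exact absurd hyz (hlt y hy).asymm
        · rw [Function.update_of_ne (hT' y hy).1.1]
          exact hd y hy z hz hyz

/-- Ramsey's theorem for pairs and finitely many colours. -/
theorem exists_monochromatic (C : Type*) [Finite C] [Nonempty C] (m : ℕ) :
    ∃ N : ℕ, ∀ (c : ℕ → ℕ → C) (S : Finset ℕ), N ≤ S.card →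
      ∃ (t : ℕ → ℕ) (col : C), StrictMonoOn t (Set.Iio m) ∧ (∀ i < m, t i ∈ S) ∧
        ∀ i j, i < j → j < m → c (t i) (t j) = col := by
  classical
  cases nonempty_fintype C
  obtain ⟨N, hN⟩ := exists_endHomogeneous (C := C) (Fintype.card C * m)
  refine ⟨N, fun c S hS => ?_⟩
  obtain ⟨T, hTS, hT, d, hd⟩ := hN c S hS
  obtain ⟨col, -, hcol⟩ := Finset.exists_le_card_fiber_of_mul_le_card_of_maps_to
    (s := T) (t := (Finset.univ : Finset C)) (f := d) (n := m)
    (fun _ _ => Finset.mem_univ _) Finset.univ_nonempty (by rw [hT, Finset.card_univ])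
  obtain ⟨U, hUT, hU⟩ := Finset.exists_subset_card_eq hcol
  have hmem : ∀ i < m, enum U i ∈ U := fun i hi => enum_mem (by omega)
  have hmono := enum_strictMonoOn U
  rw [hU] at hmono
  refine ⟨enum U, col, hmono, fun i hi => hTS (Finset.mem_filter.mp (hUT (hmem i hi))).1,
    fun i j hij hj => ?_⟩
  have hi := Finset.mem_filter.mp (hUT (hmem i (hij.trans hj)))
  have hj' := Finset.mem_filter.mp (hUT (hmem j hj))
  rw [hd _ hi.1 _ hj'.1 (hmono (hij.trans hj) hj hij), hi.2]

/-! ### Exponential lower bounds from the unavoidable structures. -/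

namespace BipartiteOrderedGraph

theorem two_pow_le_speed_of_words {P : Set BipartiteOrderedGraph}
    (h : ∀ (p : ℕ) (w : ℕ → Bool), ofMat p 1 (fun i _ => w i) ∈ P) (n : ℕ) (hn : 1 ≤ n) :
    2 ^ (n - 1) ≤ speed P n := by
  have := le_speed_of_injective (α := Fin (n - 1) → Bool) (P := P) (n := n)
    (fun w => ofMat (n - 1) 1 fun i _ => if hi : i < n - 1 then w ⟨i, hi⟩ else false) ?_
    (fun w => h _ _) (fun w => by simp; omega)
  · simpa using this
  · intro w w' hw
    funext i
    have := congrArg (fun G => G.mat i 0) hw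
    simpa [mat_ofMat _ i.2 Nat.one_pos] using this

/-- The three-valued pattern: `a` above the diagonal, `!a` on it and `c` below it. -/
def pat (a c : Bool) (s t : ℕ) : Bool := if s < t then a else if s = t then !a else c

theorem exists_first_difference {S T : Finset ℕ} (h : S ≠ T) :
    ∃ x, (∀ y < x, y ∈ S ↔ y ∈ T) ∧ ((x ∈ S ∧ x ∉ T) ∨ (x ∈ T ∧ x ∉ S)) := by
  classical
  have hex : ∃ x, ¬ (x ∈ S ↔ x ∈ T) := by
    by_contra! hc
    exact h (Finset.ext hc)
  refine ⟨Nat.find hex, fun y hy => not_not.mp (Nat.find_min hex hy), ?_⟩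
  have := Nat.find_spec hex
  tauto

/-- `S` and `T` have equally many elements below `x`, so the index of `x` in `S` points in `T` to
the first element not below `x`, which is not `x` itself. -/
theorem enum_first_difference {S T : Finset ℕ} (hc : S.card = T.card) {x : ℕ}
    (hlt : ∀ y < x, y ∈ S ↔ y ∈ T) (hS : x ∈ S) (hT : x ∉ T) :
    Nat.count (· ∈ S) x < T.card ∧ enum S (Nat.count (· ∈ S) x) = x ∧
      x < enum T (Nat.count (· ∈ S) x) := by
  have h0 : Nat.count (· ∈ S) x = Nat.count (· ∈ T) x := by
    rw [Nat.count_eq_card_filter_range, Nat.count_eq_card_filter_range]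
    congr 1
    exact Finset.filter_congr fun y hy => hlt y (Finset.mem_range.mp hy)
  have h1 : Nat.count (· ∈ S) x < T.card := hc ▸ count_lt_card hS
  refine ⟨h1, enum_count hS, ?_⟩
  rw [h0] at h1 ⊢
  refine lt_of_le_of_ne (le_enum_count h1) fun h => hT ?_
  rw [h]
  exact enum_mem h1

/-- Distinct subsets of `range n` give distinct graphs as soon as the entries tell them apart at a
first difference. -/
theorem ofMat_subset_injective {n : ℕ} (M : Finset ℕ → ℕ → ℕ → Bool)
    (hM : ∀ S T : Finset ℕ, S ⊆ Finset.range n → T ⊆ Finset.range n → S.card = T.card → ∀ x,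
      (∀ y < x, y ∈ S ↔ y ∈ T) → x ∈ S → x ∉ T →
      ∃ s < S.card, ∃ t < (Finset.range n \ S).card, M S s t ≠ M T s t) :
    Function.Injective fun S : (Finset.range n).powerset =>
      ofMat S.1.card (Finset.range n \ S.1).card (M S) := by
  rintro ⟨S, hS⟩ ⟨T, hT⟩ h
  rw [Finset.mem_powerset] at hS hT
  rw [Subtype.mk.injEq]
  by_contra hne
  have hl : S.card = T.card := congrArg left h
  have hr : (Finset.range n \ S).card = (Finset.range n \ T).card := congrArg right h
  obtain ⟨x, hx, ⟨h1, h2⟩ | ⟨h1, h2⟩⟩ := exists_first_difference hne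
  · obtain ⟨s, hs, t, ht, hst⟩ := hM S T hS hT hl x hx h1 h2
    have := congrArg (fun G => G.mat s t) h
    simp only [mat_ofMat (M S) hs ht, mat_ofMat (M T) (hl ▸ hs) (hr ▸ ht)] at this
    exact hst this
  · obtain ⟨s, hs, t, ht, hst⟩ := hM T S hT hS hl.symm x (fun y hy => (hx y hy).symm) h1 h2
    have := congrArg (fun G => G.mat s t) h
    simp only [mat_ofMat (M T) hs ht, mat_ofMat (M S) (hl ▸ hs) (hr ▸ ht)] at this
    exact hst this.symm

theorem two_pow_le_speed_of_subsets {P : Set BipartiteOrderedGraph} {n : ℕ}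
    (M : Finset ℕ → ℕ → ℕ → Bool)
    (hM : ∀ S T : Finset ℕ, S ⊆ Finset.range n → T ⊆ Finset.range n → S.card = T.card → ∀ x,
      (∀ y < x, y ∈ S ↔ y ∈ T) → x ∈ S → x ∉ T →
      ∃ s < S.card, ∃ t < (Finset.range n \ S).card, M S s t ≠ M T s t)
    (hP : ∀ S ⊆ Finset.range n, ofMat S.card (Finset.range n \ S).card (M S) ∈ P) :
    2 ^ n ≤ speed P n := by
  have := le_speed_of_injective (P := P) (n := n) _ (ofMat_subset_injective M hM)
    (fun S => hP S (Finset.mem_powerset.mp S.2)) (fun S => by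
      have h := Finset.mem_powerset.mp S.2
      rw [order_ofMat, add_comm, Finset.card_sdiff_add_card_eq_card h, Finset.card_range])
  simpa using this

/-- Take rows `S` and columns `range n \ S`. These are disjoint, so an entry records which of its
row and column comes first, and the matrix encodes the interleaving of the two sets. -/
theorem two_pow_le_speed_of_staircase {P : Set BipartiteOrderedGraph} (hP : SubClosed P) (a : Bool)
    (h : ∀ m, ofMat m m (pat a (!a)) ∈ P) (n : ℕ) : 2 ^ n ≤ speed P n := by
  refine two_pow_le_speed_of_subsets
    (fun S s t => pat a (!a) (enum S s) (enum (Finset.range n \ S) t)) ?_ ?_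
  · intro S T hS hT hc x hx h1 h2
    have hxn := Finset.mem_range.mp (hS h1)
    have hc' : (Finset.range n \ T).card = (Finset.range n \ S).card := by
      rw [Finset.card_sdiff_of_subset hS, Finset.card_sdiff_of_subset hT, hc]
    obtain ⟨e1, e2, e3⟩ := enum_first_difference hc hx h1 h2
    obtain ⟨f1, f2, f3⟩ := enum_first_difference (x := x) hc'
      (fun y hy => by simp [hx y hy]) (by simp [h2, hxn]) (by simp [h1])
    refine ⟨_, hc ▸ e1, _, f1, ?_⟩
    rw [e2, f2, pat, pat, if_pos f3, if_neg e3.not_gt, if_neg e3.ne']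
    simp
  · intro S hS
    have hC : Finset.range n \ S ⊆ Finset.range n := Finset.sdiff_subset
    refine hP.mem_of_eq (h n) (enum_strictMonoOn S) (enum_strictMonoOn _)
      (fun i hi => Finset.mem_range.mp (hS (enum_mem hi)))
      (fun i hi => Finset.mem_range.mp (hC (enum_mem hi))) fun i hi j hj => ?_
    rw [mat_ofMat _ (Finset.mem_range.mp (hS (enum_mem hi)))
      (Finset.mem_range.mp (hC (enum_mem hj)))]

/-- View `S` as a lattice path, with elements of `S` as row steps and the others as column steps.
The columns are chosen so that the entries `!a` mark the corners where a row step is immediately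
followed by a column step; with given endpoints, these corners determine the path. -/
theorem two_pow_le_speed_of_diagonal {P : Set BipartiteOrderedGraph} (hP : SubClosed P) (a : Bool)
    (h : ∀ m, ofMat m m (pat a a) ∈ P) (n : ℕ) : 2 ^ n ≤ speed P n := by
  -- A column directly after an element of `S` is moved back onto the diagonal. Truncation at `y =
  -- 0` is harmless: `col S 0 = 0` in either case.
  set col : Finset ℕ → ℕ → ℕ := fun S y => if y - 1 ∈ S then y - 1 else y with hcol
  have hcol_le : ∀ S y, col S y ≤ y := fun S y => by
    simp only [hcol]; split_ifs <;> omega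
  refine two_pow_le_speed_of_subsets
    (fun S s t => pat a a (enum S s) (col S (enum (Finset.range n \ S) t))) ?_ ?_
  · intro S T hS hT hc x hx h1 h2
    have hxn := Finset.mem_range.mp (hS h1)
    have hc' : (Finset.range n \ T).card = (Finset.range n \ S).card := by
      rw [Finset.card_sdiff_of_subset hS, Finset.card_sdiff_of_subset hT, hc]
    obtain ⟨e1, e2, e3⟩ := enum_first_difference hc hx h1 h2
    obtain ⟨f1, f2, f3⟩ := enum_first_difference (x := x) hc'
      (fun y hy => by simp [hx y hy]) (by simp [h2, hxn]) (by simp [h1])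
    set C := Finset.range n \ S with hC
    set t := Nat.count (· ∈ Finset.range n \ T) x with ht
    have ht' : t = Nat.count (· ∈ C) x := by
      rw [ht, Nat.count_eq_card_filter_range, Nat.count_eq_card_filter_range]
      congr 1
      exact Finset.filter_congr fun y hy => by simp [hC, hx y (Finset.mem_range.mp hy)]
    -- `y` is the first element after `x` outside `S`, so `y - 1` is in `S` and `S` has a corner
    -- there; in `T` the same position lies strictly below the diagonal.
    set y := enum C t with hy
    have hyC : y ∈ C := enum_mem f1
    have hyn : y < n := Finset.mem_range.mp (Finset.mem_sdiff.mp hyC).1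
    have hyS : y - 1 ∈ S := by
      by_contra hcon
      have hmem : y - 1 ∈ C := by simp [hC, hcon]; omega
      have h3 : t ≤ Nat.count (· ∈ C) (y - 1) := by
        rw [ht']; exact Nat.count_monotone _ (by omega)
      have h4 := (enum_strictMonoOn C).monotoneOn f1 (count_lt_card hmem) h3
      rw [enum_count hmem, ← hy] at h4
      omega
    have h5 : Nat.count (· ∈ S) x ≤ Nat.count (· ∈ S) (y - 1) := Nat.count_monotone _ (by omega)
    have h6 := count_lt_card hyS
    have h7 := (enum_strictMonoOn T).monotoneOn e1 (show _ < T.card from hc ▸ h6) h5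
    have h8 := hcol_le T x
    refine ⟨_, h6, t, f1, ?_⟩
    rw [enum_count hyS, f2, pat, pat, ← hy, if_neg (show ¬ enum T _ < col T x by omega),
      if_neg (show ¬ enum T _ = col T x by omega)]
    simp [hcol, hyS]
  · intro S hS
    have hC : Finset.range n \ S ⊆ Finset.range n := Finset.sdiff_subset
    have hlt : ∀ i < (Finset.range n \ S).card, col S (enum (Finset.range n \ S) i) < n :=
      fun i hi => (hcol_le S _).trans_lt (Finset.mem_range.mp (hC (enum_mem hi)))
    refine hP.mem_of_eq (h n) (enum_strictMonoOn S)
      (ψ := fun t => col S (enum (Finset.range n \ S) t)) ?_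
      (fun i hi => Finset.mem_range.mp (hS (enum_mem hi))) hlt fun i hi j hj => ?_
    · intro i hi j hj hij
      have h1 := enum_strictMonoOn _ hi hj hij
      have h2 := hcol_le S (enum (Finset.range n \ S) i)
      have h3 := (Finset.mem_sdiff.mp (enum_mem hi)).2
      by_cases h4 : enum (Finset.range n \ S) j - 1 ∈ S
      · have h5 : enum (Finset.range n \ S) i ≠ enum (Finset.range n \ S) j - 1 := fun h =>
          h3 (h ▸ h4)
        simp only [hcol, if_pos h4] at h2 ⊢
        omega
      · simp only [hcol, if_neg h4] at h2 ⊢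
        omega
    · rw [mat_ofMat _ (Finset.mem_range.mp (hS (enum_mem hi))) (hlt j hj)]

theorem two_pow_le_speed_of_pat {P : Set BipartiteOrderedGraph} (hP : SubClosed P) (a c : Bool)
    (h : ∀ m, ofMat m m (pat a c) ∈ P) (n : ℕ) : 2 ^ (n - 1) ≤ speed P n := by
  refine (Nat.pow_le_pow_right two_pos (Nat.sub_le n 1)).trans ?_
  rcases Bool.eq_or_eq_not c a with rfl | rfl
  · exact two_pow_le_speed_of_diagonal hP _ h n
  · exact two_pow_le_speed_of_staircase hP a h n

end BipartiteOrderedGraph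

/-! ### Unavoidable structures when row changes are unbounded. -/

namespace BipartiteOrderedGraph

/-- Rows `k` and `k + 1` differ. -/
def RowChange (G : BipartiteOrderedGraph) (k : ℕ) : Prop :=
  ∃ j < G.right, G.mat k j ≠ G.mat (k + 1) j

/-- One of the rows `x i` and `x i + 1` has the desired letter in column `j`. Only even indices are
used, so that the chosen rows strictly increase even when consecutive `x i` are adjacent. -/
theorem words_mem_of_alternating {P : Set BipartiteOrderedGraph} (hP : SubClosed P)
    {G : BipartiteOrderedGraph} (hG : G ∈ P) {m j : ℕ} (hj : j < G.right) {x : ℕ → ℕ}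
    (hx : StrictMonoOn x (Set.Iio (2 * m))) (hlt : ∀ i < 2 * m, x i + 1 < G.left)
    (hne : ∀ i < 2 * m, G.mat (x i) j ≠ G.mat (x i + 1) j) (w : ℕ → Bool) :
    ofMat m 1 (fun i _ => w i) ∈ P := by
  refine hP.mem_of_eq hG (φ := fun i => x (2 * i) + if G.mat (x (2 * i)) j = w i then 0 else 1)
    (ψ := fun _ => j) ?_ ?_ ?_ (fun _ _ => hj) ?_
  · intro i (hi : i < m) i' (hi' : i' < m) hii
    have h1 := hx (show 2 * i < 2 * m by omega) (show 2 * i + 1 < 2 * m by omega) (by omega)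
    have h2 := hx (show 2 * i + 1 < 2 * m by omega) (show 2 * i' < 2 * m by omega) (by omega)
    simp only
    split_ifs <;> omega
  · intro i (hi : i < 1) i' (hi' : i' < 1) hii
    omega
  · intro i hi
    have := hlt (2 * i) (by omega)
    split_ifs <;> omega
  · intro i hi _ _
    have := hne (2 * i) (by omega)
    split_ifs with h
    · exact h.symm
    · revert this h
      cases G.mat (x (2 * i)) j <;> cases G.mat (x (2 * i) + 1) j <;> cases w i <;> simp

/-- If every `a` failed at some size, none would survive at the maximum of these sizes. -/
theorem exists_forall_of_antitone {α : Type*} [Finite α] {p : α → ℕ → Prop}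
    (hp : ∀ a m m', m ≤ m' → p a m' → p a m) (h : ∀ m, ∃ a, p a m) : ∃ a, ∀ m, p a m := by
  cases nonempty_fintype α
  by_contra! hcon
  choose f hf using hcon
  obtain ⟨a, ha⟩ := h (Finset.univ.sup f)
  exact hf a (hp a _ _ (Finset.le_sup (Finset.mem_univ a)) ha)

/-- The unavoidable structures of size `m`. -/
def HasUnavoidable (P : Set BipartiteOrderedGraph) (m : ℕ) : Option (Bool × Bool × Bool) → Prop
  | none => ∀ w : ℕ → Bool, ofMat m 1 (fun i _ => w i) ∈ P
  | some (true, a, c) => ofMat m m (pat a c) ∈ P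
  | some (false, a, c) => ofMat m m (pat a c) ∈ reverse ⁻¹' P

theorem SubClosed.pat_mem_of_le {P : Set BipartiteOrderedGraph} (hP : SubClosed P) {a c : Bool}
    {m m' : ℕ} (hm : m ≤ m') (h : ofMat m' m' (pat a c) ∈ P) : ofMat m m (pat a c) ∈ P :=
  hP.mem_of_eq h (φ := id) (ψ := id) (strictMonoOn_id) (strictMonoOn_id)
    (fun _ hi => lt_of_lt_of_le hi hm) (fun _ hi => lt_of_lt_of_le hi hm)
    fun i hi j hj => by rw [mat_ofMat _ (by simp; omega) (by simp; omega)]; rfl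

theorem HasUnavoidable.of_le {P : Set BipartiteOrderedGraph} (hP : SubClosed P)
    (o : Option (Bool × Bool × Bool)) (m m' : ℕ) (hm : m ≤ m') (h : HasUnavoidable P m' o) :
    HasUnavoidable P m o := by
  match o with
  | none =>
    exact fun w => hP.mem_of_eq (h w) (φ := id) (ψ := id) (strictMonoOn_id) (strictMonoOn_id)
      (fun _ hi => lt_of_lt_of_le hi hm) (fun _ hi => hi)
      fun i hi j hj => by rw [mat_ofMat _ (by simp; omega) (by simpa using hj)]; rfl
  | some (true, a, c) => exact hP.pat_mem_of_le hm h
  | some (false, a, c) => exact hP.reverse.pat_mem_of_le hm h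

theorem exists_hasUnavoidable {P : Set BipartiteOrderedGraph} (hP : SubClosed P) (m : ℕ)
    (hU : ∀ K, ∃ G ∈ P, ∃ S : Finset ℕ, K ≤ S.card ∧ ∀ k ∈ S, k + 1 < G.left ∧ G.RowChange k) :
    ∃ o, HasUnavoidable P m o := by
  classical
  -- Five entries and two order bits per pair. The words need `2 * m` changes, and a further index,
  -- first or last, supplies the common column.
  obtain ⟨N, hN⟩ := exists_monochromatic
    (Bool × Bool × Bool × Bool × Bool × Bool × Bool) (2 * m + 2)
  obtain ⟨G, hG, S, hS, hSG⟩ := hU N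
  have hex : ∀ k, ∃ j, k ∈ S → j < G.right ∧ G.mat k j ≠ G.mat (k + 1) j := fun k => by
    by_cases hk : k ∈ S
    · obtain ⟨j, h1, h2⟩ := (hSG k hk).2
      exact ⟨j, fun _ => ⟨h1, h2⟩⟩
    · exact ⟨0, fun h => absurd h hk⟩
  choose f hf using hex
  obtain ⟨t, ⟨a, b, c, d, e, o1, o2⟩, ht, htS, hcol⟩ := hN (fun x y =>
    (G.mat x (f y), G.mat (x + 1) (f y), G.mat y (f x), G.mat (y + 1) (f x), G.mat x (f x),
      decide (f x < f y), decide (f x = f y))) S hS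
  simp only [Prod.mk.injEq] at hcol
  have hl : ∀ i < 2 * m + 2, t i + 1 < G.left := fun i hi => (hSG _ (htS i hi)).1
  have hr : ∀ i < 2 * m + 2, f (t i) < G.right := fun i hi => (hf _ (htS i hi)).1
  have hne : ∀ i < 2 * m + 2, G.mat (t i) (f (t i)) ≠ G.mat (t i + 1) (f (t i)) :=
    fun i hi => (hf _ (htS i hi)).2
  by_cases hab : a = b
  swap
  · refine ⟨none, words_mem_of_alternating hP hG (hr (2 * m + 1) (by omega)) (x := t)
      (ht.mono fun i (hi : i < 2 * m) => show i < 2 * m + 2 by omega)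
      (fun i hi => hl i (by omega)) fun i hi => ?_⟩
    obtain ⟨h1, h2, -⟩ := hcol i (2 * m + 1) (by omega) (by omega)
    rwa [h1, h2]
  by_cases hcd : c = d
  swap
  · refine ⟨none, words_mem_of_alternating hP hG (hr 0 (by omega)) (x := fun i => t (i + 1))
      (fun i (hi : i < 2 * m) j (hj : j < 2 * m) hij => ht (show i + 1 < 2 * m + 2 by omega)
        (show j + 1 < 2 * m + 2 by omega) (by omega))
      (fun i hi => hl (i + 1) (by omega)) fun i hi => ?_⟩
    obtain ⟨-, -, h1, h2, -⟩ := hcol 0 (i + 1) (by omega) (by omega)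
    rwa [h1, h2]
  subst hab hcd
  cases o2 with
  | true =>
    refine ⟨none, words_mem_of_alternating hP hG (hr (2 * m + 1) (by omega)) (x := t)
      (ht.mono fun i (hi : i < 2 * m) => show i < 2 * m + 2 by omega)
      (fun i hi => hl i (by omega)) fun i hi => ?_⟩
    obtain ⟨-, -, -, -, -, -, h1⟩ := hcol i (2 * m + 1) (by omega) (by omega)
    rw [← of_decide_eq_true h1]
    exact hne i (by omega)
  | false =>
  -- Of the two rows at a change, take the one whose diagonal entry is `!a`. Off the diagonal both
  -- rows agree, since `a = b` and `c = d`.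
  set φ : ℕ → ℕ := fun s => t s + if e = !a then 0 else 1 with hφ
  have hφm : StrictMonoOn φ (Set.Iio m) := fun i (hi : i < m) j (hj : j < m) hij => by
    have := ht (show i < 2 * m + 2 by omega) (show j < 2 * m + 2 by omega) hij
    simp only [hφ]
    omega
  have hφl : ∀ i < m, φ i < G.left := fun i hi => by
    have := hl i (by omega)
    simp only [hφ]
    split_ifs <;> omega
  have hpat : ∀ i < m, ∀ j < m, pat a c i j = G.mat (φ i) (f (t j)) := by
    intro i hi j hj
    rcases lt_trichotomy i j with h | rfl | h
    · obtain ⟨h1, h2, -⟩ := hcol i j h (by omega)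
      rw [pat, if_pos h]
      simp only [hφ]
      split_ifs
      exacts [h1.symm, h2.symm]
    · obtain ⟨-, -, -, -, h1, -⟩ := hcol i (2 * m + 1) (by omega) (by omega)
      have h2 := hne i (by omega)
      rw [pat, if_neg (lt_irrefl _), if_pos rfl]
      simp only [hφ]
      rw [h1] at h2
      split_ifs with h
      · rw [Nat.add_zero, h1, h]
      · revert h2 h
        cases e <;> cases a <;> cases G.mat (t i + 1) (f (t i)) <;> simp
    · obtain ⟨-, -, h1, h2, -⟩ := hcol j i h (by omega)
      rw [pat, if_neg h.not_gt, if_neg h.ne']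
      simp only [hφ]
      split_ifs
      exacts [h1.symm, h2.symm]
  cases o1 with
  | true =>
    refine ⟨some (true, a, c), hP.mem_of_eq hG hφm (ψ := fun j => f (t j)) ?_ hφl
      (fun j hj => hr j (by omega)) hpat⟩
    intro i (hi : i < m) j (hj : j < m) hij
    obtain ⟨-, -, -, -, -, h1, -⟩ := hcol i j hij (by omega)
    exact of_decide_eq_true h1
  | false =>
    refine ⟨some (false, a, c), hP.reverse.mem_of_eq (G := G.reverse) ?_ hφm
      (ψ := fun j => G.right - 1 - f (t j)) ?_ hφl ?_ ?_⟩
    · rw [Set.mem_preimage, reverse_reverse]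
      exact hG
    · intro i (hi : i < m) j (hj : j < m) hij
      obtain ⟨-, -, -, -, -, h1, h2⟩ := hcol i j hij (by omega)
      have h1 := of_decide_eq_false h1
      have h2 := of_decide_eq_false h2
      have h3 := hr i (by omega)
      simp only
      omega
    · intro j hj
      have h3 := hr j (by omega)
      simp only [right_reverse]
      omega
    · intro i hi j hj
      have h3 := hr j (by omega)
      rw [mat_reverse _ (hφl i hi) (by omega), hpat i hi j hj]
      congr 1
      omega

theorem two_pow_le_speed_of_unbounded {P : Set BipartiteOrderedGraph} (hP : SubClosed P)
    (hU : ∀ K, ∃ G ∈ P, ∃ S : Finset ℕ, K ≤ S.card ∧ ∀ k ∈ S, k + 1 < G.left ∧ G.RowChange k)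
    (n : ℕ) (hn : 1 ≤ n) : 2 ^ (n - 1) ≤ speed P n := by
  obtain ⟨o, ho⟩ := exists_forall_of_antitone (p := fun o m => HasUnavoidable P m o)
    (fun o m m' => HasUnavoidable.of_le hP o m m') (fun m => exists_hasUnavoidable hP m hU)
  match o with
  | none => exact two_pow_le_speed_of_words ho n hn
  | some (true, a, c) => exact two_pow_le_speed_of_pat hP a c ho n
  | some (false, a, c) =>
    rw [← speed_reverse]
    exact two_pow_le_speed_of_pat hP.reverse a c ho n

end BipartiteOrderedGraph

/-! ### Eventually polynomial sequences. -/

/-- Integer-valued sequences that are eventually integer combinations of binomial coefficients. -/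
def eventuallyPoly : Submodule ℤ (ℕ → ℤ) :=
  Submodule.span ℤ (Set.range (fun i n => ((n.choose i : ℕ) : ℤ)) ∪
    {f | ∃ N, ∀ n, N ≤ n → f n = 0})

theorem choose_mem_eventuallyPoly (i : ℕ) :
    (fun n => ((n.choose i : ℕ) : ℤ)) ∈ eventuallyPoly :=
  Submodule.subset_span (Or.inl ⟨i, rfl⟩)

theorem mem_eventuallyPoly_of_eventually_zero {f : ℕ → ℤ} (N : ℕ) (h : ∀ n, N ≤ n → f n = 0) :
    f ∈ eventuallyPoly :=
  Submodule.subset_span (Or.inr ⟨N, h⟩)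

theorem mem_eventuallyPoly_congr {f g : ℕ → ℤ} (N : ℕ) (h : ∀ n, N ≤ n → f n = g n)
    (hg : g ∈ eventuallyPoly) : f ∈ eventuallyPoly := by
  have := eventuallyPoly.add_mem (mem_eventuallyPoly_of_eventually_zero (f := f - g) N
    fun n hn => sub_eq_zero.mpr (h n hn)) hg
  rwa [sub_add_cancel] at this

theorem eventuallyPoly_map_le (F : (ℕ → ℤ) →ₗ[ℤ] (ℕ → ℤ))
    (h1 : ∀ i, F (fun n => ((n.choose i : ℕ) : ℤ)) ∈ eventuallyPoly)
    (h2 : ∀ (f : ℕ → ℤ) (N : ℕ), (∀ n, N ≤ n → f n = 0) → F f ∈ eventuallyPoly)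
    {f : ℕ → ℤ} (hf : f ∈ eventuallyPoly) : F f ∈ eventuallyPoly := by
  induction hf using Submodule.span_induction with
  | mem f hf =>
    rcases hf with ⟨i, rfl⟩ | ⟨N, hN⟩
    exacts [h1 i, h2 f N hN]
  | zero => simp
  | add f g _ _ hf hg => rw [map_add]; exact eventuallyPoly.add_mem hf hg
  | smul c f _ hf => rw [map_smul]; exact eventuallyPoly.smul_mem c hf

/-- The sequence delayed by one step. -/
def delay : (ℕ → ℤ) →ₗ[ℤ] (ℕ → ℤ) where
  toFun f n := if n = 0 then 0 else f (n - 1)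
  map_add' f g := by ext n; by_cases h : n = 0 <;> simp [h]
  map_smul' c f := by ext n; by_cases h : n = 0 <;> simp [h]

theorem delay_succ (f : ℕ → ℤ) (n : ℕ) : delay f (n + 1) = f n := by simp [delay]

/-- The sequence of partial sums. -/
def partialSum : (ℕ → ℤ) →ₗ[ℤ] (ℕ → ℤ) where
  toFun f n := ∑ m ∈ Finset.range (n + 1), f m
  map_add' f g := by ext n; simp [Finset.sum_add_distrib]
  map_smul' c f := by ext n; simp [Finset.mul_sum]

/-- Pascal's rule expresses the delay of one binomial sequence through that of the previous one. -/
theorem delay_mem {f : ℕ → ℤ} (hf : f ∈ eventuallyPoly) : delay f ∈ eventuallyPoly := by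
  refine eventuallyPoly_map_le delay (fun i => ?_) (fun f N hN => ?_) hf
  · induction i with
    | zero =>
      refine mem_eventuallyPoly_congr 1 (fun n hn => ?_) (choose_mem_eventuallyPoly 0)
      obtain ⟨n, rfl⟩ := Nat.exists_eq_add_of_le' hn
      simp [delay_succ]
    | succ i ih =>
      refine mem_eventuallyPoly_congr 1 (fun n hn => ?_)
        (eventuallyPoly.sub_mem (choose_mem_eventuallyPoly (i + 1)) ih)
      obtain ⟨n, rfl⟩ := Nat.exists_eq_add_of_le' hn
      simp only [Pi.sub_apply, delay_succ, Nat.choose_succ_succ']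
      push_cast
      ring
  · refine mem_eventuallyPoly_of_eventually_zero (N + 1) fun n hn => ?_
    obtain ⟨n, rfl⟩ := Nat.exists_eq_add_of_le' (show 1 ≤ n by omega)
    rw [delay_succ]
    exact hN n (by omega)

/-- The hockey-stick identity handles binomials; eventually zero sequences have eventually constant
partial sums. -/
theorem partialSum_mem {f : ℕ → ℤ} (hf : f ∈ eventuallyPoly) : partialSum f ∈ eventuallyPoly := by
  refine eventuallyPoly_map_le partialSum (fun i => ?_) (fun f N hN => ?_) hf
  · refine mem_eventuallyPoly_congr 0 (fun n _ => ?_)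
      (eventuallyPoly.add_mem (choose_mem_eventuallyPoly i) (choose_mem_eventuallyPoly (i + 1)))
    simp only [Pi.add_apply, partialSum, LinearMap.coe_mk, AddHom.coe_mk]
    induction n with
    | zero => simp
    | succ n ih =>
      rw [Finset.sum_range_succ, ih (Nat.zero_le _), Nat.choose_succ_succ']
      push_cast
      ring
  · refine mem_eventuallyPoly_congr N (fun n hn => ?_)
      (eventuallyPoly.smul_mem (partialSum f N) (choose_mem_eventuallyPoly 0))
    simp only [partialSum, LinearMap.coe_mk, AddHom.coe_mk, Pi.smul_apply, Nat.choose_zero_right,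
      Nat.cast_one, smul_eq_mul, mul_one]
    refine (Finset.sum_subset (fun m hm => ?_) fun m _ hm => ?_).symm
    · simp only [Finset.mem_range] at hm ⊢; omega
    · simp only [Finset.mem_range] at hm
      exact hN m (by omega)

theorem exists_eq_sum_choose {f : ℕ → ℤ} (hf : f ∈ eventuallyPoly) :
    ∃ (k : ℕ) (a : Fin (k + 1) → ℤ), ∃ N : ℕ, ∀ n : ℕ, N ≤ n →
      f n = ∑ i : Fin (k + 1), a i * (n.choose (i : ℕ) : ℤ) := by
  -- Allowing every upper limit `l ≥ k` lets summands of different degree be added.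
  suffices h : ∃ (a : ℕ → ℤ) (k N : ℕ), (∀ i, k < i → a i = 0) ∧ ∀ n, N ≤ n → ∀ l, k ≤ l →
      f n = ∑ i ∈ Finset.range (l + 1), a i * (n.choose i : ℤ) by
    obtain ⟨a, k, N, -, h⟩ := h
    refine ⟨k, fun i => a i, N, fun n hn => ?_⟩
    rw [h n hn k le_rfl, Finset.sum_range]
  induction hf using Submodule.span_induction with
  | mem f hf =>
    rcases hf with ⟨i, rfl⟩ | ⟨N, hN⟩
    · refine ⟨Pi.single i 1, i, 0, fun j hj => Pi.single_eq_of_ne hj.ne' _, fun n _ l hl => ?_⟩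
      rw [Finset.sum_eq_single i]
      · simp
      · intro j _ hj
        rw [Pi.single_eq_of_ne hj, zero_mul]
      · simp; omega
    · exact ⟨0, 0, N, by simp, fun n hn l _ => by simp [hN n hn]⟩
  | zero => exact ⟨0, 0, 0, by simp, fun n _ l _ => by simp⟩
  | add f g _ _ hf hg =>
    obtain ⟨a, k, N, h1, h2⟩ := hf
    obtain ⟨b, k', N', h3, h4⟩ := hg
    refine ⟨a + b, max k k', max N N', fun i hi => ?_, fun n hn l hl => ?_⟩
    · simp [h1 i (by omega), h3 i (by omega)]
    · simp only [Pi.add_apply, add_mul, Finset.sum_add_distrib]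
      rw [h2 n (by omega) l (by omega), h4 n (by omega) l (by omega)]
  | smul c f _ hf =>
    obtain ⟨a, k, N, h1, h2⟩ := hf
    refine ⟨c • a, k, N, fun i hi => by simp [h1 i hi], fun n hn l hl => ?_⟩
    simp only [Pi.smul_apply, smul_eq_mul, h2 n hn l hl, Finset.mul_sum, mul_assoc]

/-- Split off `g 0` and delay the rest until all remaining sequences coincide; what is left is a
partial sum. -/
theorem convolution_mem (J : ℕ) : ∀ g : ℕ → ℕ → ℤ, (∀ j, g j ∈ eventuallyPoly) →
    (∀ j, J ≤ j → g j = g J) →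
    (fun n => ∑ x ∈ Finset.HasAntidiagonal.antidiagonal n, g x.1 x.2) ∈ eventuallyPoly := by
  induction J with
  | zero =>
    intro g hg hJ
    convert partialSum_mem (hg 0) using 1
    ext n
    simp only [partialSum, LinearMap.coe_mk, AddHom.coe_mk]
    rw [Finset.Nat.sum_antidiagonal_eq_sum_range_succ (fun i j => g i j) n]
    rw [← Finset.sum_range_reflect]
    refine Finset.sum_congr rfl fun i hi => ?_
    rw [Finset.mem_range] at hi
    rw [hJ _ (Nat.zero_le _)]
    congr 1
    omega
  | succ J ih =>
    intro g hg hJ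
    have h1 := ih (fun j => g (j + 1)) (fun j => hg _) fun j hj => hJ _ (by omega)
    refine mem_eventuallyPoly_congr 1 (fun n hn => ?_) (eventuallyPoly.add_mem (hg 0) (delay_mem h1))
    obtain ⟨n, rfl⟩ := Nat.exists_eq_add_of_le' hn
    rw [Finset.Nat.sum_antidiagonal_succ, Pi.add_apply, delay_succ]

/-! ### Counting points of support-lower sets. -/

/-- Closure under decreasing coordinates without making a positive coordinate vanish. -/
def SupportLower {ι : Type*} (E : Set (ι → ℕ)) : Prop :=
  ∀ x ∈ E, ∀ y : ι → ℕ, (∀ i, y i ≤ x i) → (∀ i, y i = 0 → x i = 0) → y ∈ E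

theorem SupportLower.cons {d : ℕ} {E : Set (Fin (d + 1) → ℕ)} (hE : SupportLower E) (j : ℕ) :
    SupportLower {x : Fin d → ℕ | (Fin.cons j x : Fin (d + 1) → ℕ) ∈ E} := by
  intro x hx y hyx hy
  refine hE _ hx _ (fun i => ?_) (fun i => ?_) <;> refine Fin.cases ?_ (fun i => ?_) i
  · simp
  · simpa using hyx i
  · simp
  · simpa using hy i

theorem SupportLower.mem_cons_of_le {d : ℕ} {E : Set (Fin (d + 1) → ℕ)} (hE : SupportLower E)
    {j j' : ℕ} (hj : 1 ≤ j) (hjj : j ≤ j') {x y : Fin d → ℕ}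
    (hx : (Fin.cons j' x : Fin (d + 1) → ℕ) ∈ E) (hyx : ∀ i, y i ≤ x i)
    (hy : ∀ i, y i = 0 → x i = 0) : (Fin.cons j y : Fin (d + 1) → ℕ) ∈ E := by
  refine hE _ hx _ (fun i => ?_) (fun i => ?_) <;> refine Fin.cases ?_ (fun i => ?_) i
  · simpa using hjj
  · simpa using hyx i
  · simp; omega
  · simpa using hy i

/-- The slices at positive height decrease with the height. An infinite strict descent would yield
points `x J` lying at height `J + 1` but missing at a greater height `j J`, which contradicts
Dickson's lemma. -/
theorem SupportLower.exists_stable {d : ℕ} {E : Set (Fin (d + 1) → ℕ)} (hE : SupportLower E) :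
    ∃ J : ℕ, ∀ j, J ≤ j → ∀ x : Fin d → ℕ,
      (Fin.cons j x : Fin (d + 1) → ℕ) ∈ E ↔ (Fin.cons J x : Fin (d + 1) → ℕ) ∈ E := by
  by_contra! hcon
  have h : ∀ J : ℕ, ∃ (j : ℕ) (x : Fin d → ℕ), J + 1 ≤ j ∧
      (Fin.cons (J + 1) x : Fin (d + 1) → ℕ) ∈ E ∧ (Fin.cons j x : Fin (d + 1) → ℕ) ∉ E := by
    intro J
    obtain ⟨j, hj, x, hx⟩ := hcon (J + 1)
    have := fun h => hE.mem_cons_of_le (j := J + 1) (j' := j) (x := x) (y := x) (by omega) hj h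
      (fun _ => le_rfl) (fun _ => id)
    exact ⟨j, x, hj, by tauto⟩
  choose j x hj h1 h2 using h
  -- The truncated `1 - x J i` is the indicator of `x J i = 0`, so comparable pairs also satisfy the
  -- condition on zeros.
  obtain ⟨g, hg⟩ := (wellQuasiOrdered_le (α := Fin d → ℕ × ℕ)).exists_monotone_subseq
    (fun J i => (x J i, 1 - x J i))
  have hle : j (g 0) ≤ g (j (g 0)) + 1 := (g.strictMono.le_apply).trans (Nat.le_succ _)
  have hmono := hg 0 (j (g 0)) (Nat.zero_le _)
  refine h2 (g 0) (hE.mem_cons_of_le ((Nat.le_add_left 1 _).trans (hj _)) hle (h1 (g (j (g 0))))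
    (fun i => (hmono i).1) fun i hi => ?_)
  have h3 := (hmono i).2
  simp only at h3
  omega

open Classical in
/-- The number of points of `E` with coordinate sum `n`. -/
noncomputable def sumCount {d : ℕ} (E : Set (Fin d → ℕ)) (n : ℕ) : ℕ :=
  ((Finset.Nat.antidiagonalTuple d n).filter (· ∈ E)).card

theorem sumCount_cons {d : ℕ} (E : Set (Fin (d + 1) → ℕ)) (n : ℕ) :
    sumCount E n = ∑ x ∈ Finset.HasAntidiagonal.antidiagonal n,
      sumCount {y : Fin d → ℕ | (Fin.cons x.1 y : Fin (d + 1) → ℕ) ∈ E} x.2 := by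
  classical
  simp only [sumCount]
  rw [← Finset.card_sigma]
  refine Finset.card_bij' (fun x _ => ⟨(x 0, ∑ i : Fin d, x i.succ), Fin.tail x⟩)
    (fun z _ => Fin.cons z.1.1 z.2) ?_ ?_ ?_ ?_
  · intro x hx
    simp only [Finset.mem_filter, Finset.Nat.mem_antidiagonalTuple, Fin.sum_univ_succ] at hx
    simp only [Finset.mem_sigma, Finset.HasAntidiagonal.mem_antidiagonal, Finset.mem_filter,
      Finset.Nat.mem_antidiagonalTuple, Set.mem_ofPred_eq, Fin.cons_self_tail]
    exact ⟨hx.1, rfl, hx.2⟩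
  · rintro ⟨⟨j, m⟩, y⟩ hy
    simp only [Finset.mem_sigma, Finset.HasAntidiagonal.mem_antidiagonal, Finset.mem_filter,
      Finset.Nat.mem_antidiagonalTuple, Set.mem_ofPred_eq] at hy
    simp only [Finset.mem_filter, Finset.Nat.mem_antidiagonalTuple, Fin.sum_univ_succ,
      Fin.cons_zero, Fin.cons_succ]
    exact ⟨by rw [hy.2.1, hy.1], hy.2.2⟩
  · intro x _
    exact Fin.cons_self_tail x
  · rintro ⟨⟨j, m⟩, y⟩ hy
    simp only [Finset.mem_sigma, Finset.HasAntidiagonal.mem_antidiagonal, Finset.mem_filter,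
      Finset.Nat.mem_antidiagonalTuple, Set.mem_ofPred_eq] at hy
    simp [hy.2.1]

/-- Slice along the first coordinate: each slice is handled by induction, and from some height on
they are all equal. -/
theorem SupportLower.sumCount_mem {d : ℕ} : ∀ {E : Set (Fin d → ℕ)}, SupportLower E →
    (fun n => (sumCount E n : ℤ)) ∈ eventuallyPoly := by
  induction d with
  | zero =>
    intro E _
    refine mem_eventuallyPoly_of_eventually_zero 1 fun n hn => ?_
    obtain ⟨n, rfl⟩ := Nat.exists_eq_add_of_le' hn
    simp [sumCount]
  | succ d ih =>
    intro E hE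
    obtain ⟨J, hJ⟩ := hE.exists_stable
    have := convolution_mem J (fun j n =>
      (sumCount {y : Fin d → ℕ | (Fin.cons j y : Fin (d + 1) → ℕ) ∈ E} n : ℤ))
      (fun j => ih (hE.cons j)) fun j hj => by
        have : {y : Fin d → ℕ | (Fin.cons j y : Fin (d + 1) → ℕ) ∈ E} =
          {y : Fin d → ℕ | (Fin.cons J y : Fin (d + 1) → ℕ) ∈ E} := Set.ext (hJ j hj)
        rw [this]
    convert this using 2 with n
    rw [sumCount_cons]
    push_cast
    rfl

/-! ### Blocks of equal rows and columns. -/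

namespace BipartiteOrderedGraph

/-- `f` numbers the maximal blocks of equal consecutive rows of `G` by `0, 1, 2, …`. -/
structure IsRowLabel (G : BipartiteOrderedGraph) (f : ℕ → ℕ) : Prop where
  mono : ∀ i i', i ≤ i' → i' < G.left → f i ≤ f i'
  initial : ∀ i < G.left, ∀ k < f i, ∃ i' < G.left, f i' = k
  same : ∀ i < G.left, ∀ i' < G.left, f i = f i' → ∀ j < G.right, G.mat i j = G.mat i' j
  diff : ∀ i < G.left, ∀ i' < G.left, f i' = f i + 1 → ∃ j < G.right, G.mat i j ≠ G.mat i' j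

open Classical in
/-- The number of row changes above row `i`. -/
noncomputable def rowLabel (G : BipartiteOrderedGraph) (i : ℕ) : ℕ := Nat.count G.RowChange i

/-- The four axioms pin the labelling down, so the labels of a submatrix can be identified by
checking them. -/
theorem IsRowLabel.eq_rowLabel {G : BipartiteOrderedGraph} {f : ℕ → ℕ} (hf : G.IsRowLabel f)
    {i : ℕ} (hi : i < G.left) : f i = G.rowLabel i := by
  classical
  induction i with
  | zero =>
    rw [rowLabel, Nat.count_zero]
    by_contra h
    obtain ⟨i', h1, h2⟩ := hf.initial 0 hi 0 (Nat.pos_of_ne_zero h)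
    have := hf.mono 0 i' (Nat.zero_le _) h1
    omega
  | succ i ih =>
    have ih := ih (by omega)
    have hle := hf.mono i (i + 1) (Nat.le_succ i) hi
    rw [rowLabel, Nat.count_succ, ← rowLabel, ← ih]
    rcases hle.eq_or_lt with h | h
    · rw [if_neg, ← h, Nat.add_zero]
      rintro ⟨j, hj, hne⟩
      exact hne (hf.same i (by omega) (i + 1) hi h j hj)
    · have h1 : f (i + 1) = f i + 1 := by
        by_contra hne
        obtain ⟨i', h1, h2⟩ := hf.initial (i + 1) hi (f i + 1) (by omega)
        rcases le_or_gt i' i with h3 | h3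
        · have := hf.mono i' i h3 (by omega)
          omega
        · have := hf.mono (i + 1) i' h3 h1
          omega
      rw [h1, if_pos]
      exact hf.diff i (by omega) (i + 1) hi h1

theorem rowLabel_mono (G : BipartiteOrderedGraph) : Monotone G.rowLabel := by
  classical
  exact Nat.count_monotone _

theorem rowLabel_succ_le (G : BipartiteOrderedGraph) (i : ℕ) :
    G.rowLabel (i + 1) ≤ G.rowLabel i + 1 := by
  classical
  rw [rowLabel, Nat.count_succ, ← rowLabel]
  split_ifs <;> omega

theorem exists_rowLabel_eq (G : BipartiteOrderedGraph) {i k : ℕ} (hk : k ≤ G.rowLabel i) :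
    ∃ i' ≤ i, G.rowLabel i' = k := by
  induction i with
  | zero => exact ⟨0, le_rfl, by simp [rowLabel] at hk ⊢; omega⟩
  | succ i ih =>
    rcases le_or_gt k (G.rowLabel i) with h | h
    · obtain ⟨i', h1, h2⟩ := ih h
      exact ⟨i', by omega, h2⟩
    · have := G.rowLabel_succ_le i
      exact ⟨i + 1, le_rfl, by omega⟩

theorem mat_eq_of_rowLabel_eq_of_le (G : BipartiteOrderedGraph) {i i' : ℕ} (hii : i ≤ i')
    (h : G.rowLabel i = G.rowLabel i') {j : ℕ} (hj : j < G.right) : G.mat i j = G.mat i' j := by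
  classical
  induction i', hii using Nat.le_induction with
  | base => rfl
  | succ i' hi ih =>
    have h1 := G.rowLabel_mono hi
    have h2 := G.rowLabel_mono (Nat.le_succ i')
    rw [ih (by simp only [Nat.succ_eq_add_one] at h2; omega)]
    have h3 : ¬ G.RowChange i' := fun hc => by
      have h4 : G.rowLabel (i' + 1) = G.rowLabel i' + 1 := by
        rw [rowLabel, Nat.count_succ, if_pos hc, ← rowLabel]
      omega
    by_contra hne
    exact h3 ⟨j, hj, hne⟩

theorem mat_eq_of_rowLabel_eq (G : BipartiteOrderedGraph) {i i' : ℕ}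
    (h : G.rowLabel i = G.rowLabel i') {j : ℕ} (hj : j < G.right) : G.mat i j = G.mat i' j := by
  rcases le_total i i' with hii | hii
  · exact G.mat_eq_of_rowLabel_eq_of_le hii h hj
  · exact (G.mat_eq_of_rowLabel_eq_of_le hii h.symm hj).symm

theorem isRowLabel_rowLabel (G : BipartiteOrderedGraph) : G.IsRowLabel G.rowLabel where
  mono _ _ h _ := G.rowLabel_mono h
  initial i hi k hk := by
    obtain ⟨i', h1, h2⟩ := G.exists_rowLabel_eq hk.le
    exact ⟨i', by omega, h2⟩
  same _ _ _ _ h _ hj := G.mat_eq_of_rowLabel_eq h hj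
  diff i hi i' hi' h := by
    classical
    -- The first row with the next label comes right after a change; its column also separates `i`
    -- from `i'`, by constancy on blocks.
    have hex : ∃ l, G.rowLabel l = G.rowLabel i + 1 := ⟨i', h⟩
    have h1 := Nat.find_spec hex
    obtain ⟨k, hk⟩ : ∃ k, Nat.find hex = k + 1 := Nat.exists_eq_add_one_of_ne_zero fun h0 => by
      rw [h0] at h1
      simp [rowLabel] at h1
    rw [hk] at h1
    have h2 : G.rowLabel k ≠ G.rowLabel i + 1 := Nat.find_min hex (by omega)
    have h3 := G.rowLabel_succ_le k
    have h4 := G.rowLabel_mono (Nat.le_succ k)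
    have hc : G.RowChange k := by
      by_contra hc
      have h5 : G.rowLabel (k + 1) = G.rowLabel k := by
        rw [rowLabel, Nat.count_succ, if_neg hc, ← rowLabel, Nat.add_zero]
      omega
    obtain ⟨j, hj, hne⟩ := hc
    refine ⟨j, hj, ?_⟩
    rwa [G.mat_eq_of_rowLabel_eq (i := i) (i' := k)
        (by simp only [Nat.succ_eq_add_one] at h4; omega) hj,
      G.mat_eq_of_rowLabel_eq (i := i') (i' := k + 1) (by omega) hj]

theorem mat_eq_of_labels_eq (G : BipartiteOrderedGraph) {i i' j j' : ℕ} (hi' : i' < G.left)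
    (hj : j < G.right) (hj' : j' < G.right) (h : G.rowLabel i = G.rowLabel i')
    (h' : G.transpose.rowLabel j = G.transpose.rowLabel j') : G.mat i j = G.mat i' j' := by
  rw [G.mat_eq_of_rowLabel_eq h hj, ← mat_transpose G hj hi', ← mat_transpose G hj' hi']
  exact G.transpose.mat_eq_of_rowLabel_eq h' hi'

/-- The induced subgraph on a set of rows and a set of columns. -/
noncomputable def restrict (G : BipartiteOrderedGraph) (S T : Finset ℕ) : BipartiteOrderedGraph :=
  ofMat S.card T.card fun i j => G.mat (enum S i) (enum T j)

@[simp] theorem left_restrict (G : BipartiteOrderedGraph) (S T : Finset ℕ) :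
    (G.restrict S T).left = S.card := rfl

@[simp] theorem right_restrict (G : BipartiteOrderedGraph) (S T : Finset ℕ) :
    (G.restrict S T).right = T.card := rfl

theorem mat_restrict (G : BipartiteOrderedGraph) {S T : Finset ℕ} {i j : ℕ} (hi : i < S.card)
    (hj : j < T.card) : (G.restrict S T).mat i j = G.mat (enum S i) (enum T j) :=
  mat_ofMat _ hi hj

theorem SubClosed.restrict_mem {P : Set BipartiteOrderedGraph} (hP : SubClosed P)
    {G : BipartiteOrderedGraph} (hG : G ∈ P) {S T : Finset ℕ} (hS : S ⊆ Finset.range G.left)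
    (hT : T ⊆ Finset.range G.right) : G.restrict S T ∈ P :=
  hP G hG _ _ _ _ (enum_strictMonoOn S) (enum_strictMonoOn T)
    (fun _ hi => Finset.mem_range.mp (hS (enum_mem hi)))
    (fun _ hi => Finset.mem_range.mp (hT (enum_mem hi)))

theorem transpose_restrict (G : BipartiteOrderedGraph) {S T : Finset ℕ}
    (hS : S ⊆ Finset.range G.left) (hT : T ⊆ Finset.range G.right) :
    (G.restrict S T).transpose = G.transpose.restrict T S :=
  ofMat_congr fun i (hi : i < T.card) j (hj : j < S.card) => by
    rw [mat_restrict G hj hi, mat_transpose G (Finset.mem_range.mp (hT (enum_mem hi)))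
      (Finset.mem_range.mp (hS (enum_mem hj)))]

/-- `S` is a set of rows that meets every block of equal consecutive rows. -/
def MeetsRowBlocks (G : BipartiteOrderedGraph) (S : Finset ℕ) : Prop :=
  S ⊆ Finset.range G.left ∧ ∀ i < G.left, ∃ s < S.card, G.rowLabel (enum S s) = G.rowLabel i

/-- `S` meets every row block, so no label is skipped; `T` meets every column block, so a column
separating two row blocks has a representative in `T`. -/
theorem rowLabel_restrict {G : BipartiteOrderedGraph} {S T : Finset ℕ} (hS : G.MeetsRowBlocks S)
    (hT : G.transpose.MeetsRowBlocks T) {i : ℕ} (hi : i < S.card) :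
    (G.restrict S T).rowLabel i = G.rowLabel (enum S i) := by
  refine (IsRowLabel.eq_rowLabel (f := fun i => G.rowLabel (enum S i)) ?_ hi).symm
  have hSl : ∀ {i}, i < S.card → enum S i < G.left := fun hi =>
    Finset.mem_range.mp (hS.1 (enum_mem hi))
  have hTr : ∀ {i}, i < T.card → enum T i < G.right := fun hi =>
    Finset.mem_range.mp (hT.1 (enum_mem hi))
  constructor
  · intro i i' hii (hi' : i' < S.card)
    exact G.rowLabel_mono
      ((enum_strictMonoOn S).monotoneOn (hii.trans_lt hi') hi' hii)
  · intro i (hi : i < S.card) k hk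
    obtain ⟨i', h1, h2⟩ := G.isRowLabel_rowLabel.initial _ (hSl hi) k hk
    obtain ⟨s, h3, h4⟩ := hS.2 i' h1
    exact ⟨s, h3, h4.trans h2⟩
  · intro i (hi : i < S.card) i' (hi' : i' < S.card) h j (hj : j < T.card)
    rw [mat_restrict G hi hj, mat_restrict G hi' hj]
    exact G.mat_eq_of_rowLabel_eq h (hTr hj)
  · intro i (hi : i < S.card) i' (hi' : i' < S.card) h
    obtain ⟨j, hj, hne⟩ := G.isRowLabel_rowLabel.diff _ (hSl hi) _ (hSl hi') h
    obtain ⟨t, h3, h4⟩ := hT.2 j hj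
    refine ⟨t, h3, ?_⟩
    rwa [mat_restrict G hi h3, mat_restrict G hi' h3,
      G.mat_eq_of_labels_eq (hSl hi) (hTr h3) hj rfl h4,
      G.mat_eq_of_labels_eq (hSl hi') (hTr h3) hj rfl h4]

/-- The size of the `k`-th block of equal consecutive rows. -/
noncomputable def blockSize (G : BipartiteOrderedGraph) (k : ℕ) : ℕ :=
  ((Finset.range G.left).filter fun i => G.rowLabel i = k).card

theorem blockSize_restrict {G : BipartiteOrderedGraph} {S T : Finset ℕ} (hS : G.MeetsRowBlocks S)
    (hT : G.transpose.MeetsRowBlocks T) (k : ℕ) :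
    (G.restrict S T).blockSize k = (S.filter fun i => G.rowLabel i = k).card := by
  classical
  have h : (Finset.range S.card).filter (fun i => (G.restrict S T).rowLabel i = k) =
      (Finset.range S.card).filter fun i => G.rowLabel (enum S i) = k :=
    Finset.filter_congr fun i hi => by rw [rowLabel_restrict hS hT (Finset.mem_range.mp hi)]
  rw [blockSize, left_restrict, h]
  conv_rhs => rw [← image_enum S, Finset.filter_image]
  rw [Finset.card_image_of_injOn]
  intro i hi j hj hij
  simp only [Finset.coe_filter, Finset.mem_range, Set.mem_ofPred_eq] at hi hj
  exact (enum_strictMonoOn S).injOn hi.1 hj.1 hij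

theorem blockSize_pos_iff {G : BipartiteOrderedGraph} {k : ℕ} :
    0 < G.blockSize k ↔ ∃ i < G.left, G.rowLabel i = k := by
  rw [blockSize, Finset.card_pos]
  constructor
  · rintro ⟨i, hi⟩
    exact ⟨i, by simpa using hi⟩
  · rintro ⟨i, hi, h⟩
    exact ⟨i, by simp [hi, h]⟩

theorem exists_meetsRowBlocks (G : BipartiteOrderedGraph) {x : ℕ → ℕ}
    (hx : ∀ k, x k ≤ G.blockSize k) (hx0 : ∀ k, x k = 0 → G.blockSize k = 0) :
    ∃ S, G.MeetsRowBlocks S ∧ ∀ k, (S.filter fun i => G.rowLabel i = k).card = x k := by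
  classical
  choose U hU hUc using fun k => Finset.exists_subset_card_eq (hx k)
  have hmem : ∀ k, ∀ i ∈ U k, i < G.left ∧ G.rowLabel i = k := fun k i hi => by
    simpa using hU k hi
  set S := (Finset.range G.left).filter fun i => i ∈ U (G.rowLabel i) with hS
  have hSU : ∀ k, (S.filter fun i => G.rowLabel i = k) = U k := fun k => by
    ext i
    simp only [hS, Finset.mem_filter, Finset.mem_range]
    constructor
    · rintro ⟨⟨-, h⟩, rfl⟩
      exact h
    · intro h
      obtain ⟨h1, h2⟩ := hmem k i h
      exact ⟨⟨h1, by rwa [h2]⟩, h2⟩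
  refine ⟨S, ⟨Finset.filter_subset _ _, fun i hi => ?_⟩, fun k => by rw [hSU, hUc]⟩
  have h1 : (U (G.rowLabel i)).Nonempty := by
    rw [← Finset.card_pos, hUc]
    refine Nat.pos_of_ne_zero fun h => ?_
    exact (blockSize_pos_iff.mpr ⟨i, hi, rfl⟩).ne' (hx0 _ h)
  obtain ⟨s, hs⟩ := h1
  have hs' : s ∈ S := by
    rw [← hSU] at hs
    exact (Finset.mem_filter.mp hs).1
  exact ⟨_, count_lt_card hs', by rw [enum_count hs', (hmem _ s hs).2]⟩

theorem card_filter_le_eq_sum (f : ℕ → ℕ) (p k : ℕ) :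
    ((Finset.range p).filter fun i => f i ≤ k).card =
      ∑ l ∈ Finset.range (k + 1), ((Finset.range p).filter fun i => f i = l).card := by
  rw [Finset.card_eq_sum_card_fiberwise (f := f) (t := Finset.range (k + 1))
    fun i hi => by simp at hi ⊢; omega]
  refine Finset.sum_congr rfl fun l hl => ?_
  rw [Finset.filter_filter]
  congr 1
  refine Finset.filter_congr fun i _ => ?_
  simp only [Finset.mem_range] at hl
  omega

/-- If `f i < g i`, then at least `i + 1` indices have `f`-value at most `f i` but at most `i` have
such a `g`-value, although fibre sizes determine both counts. -/
theorem le_of_card_fibers_eq {f g : ℕ → ℕ} (hf : Monotone f) (hg : Monotone g) {p : ℕ}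
    (h : ∀ k, ((Finset.range p).filter fun i => f i = k).card =
      ((Finset.range p).filter fun i => g i = k).card) {i : ℕ} (hi : i < p) : g i ≤ f i := by
  by_contra! hlt
  have h1 : Finset.range (i + 1) ⊆ (Finset.range p).filter fun l => f l ≤ f i := fun l hl => by
    simp only [Finset.mem_range, Finset.mem_filter] at hl ⊢
    exact ⟨by omega, hf (by omega)⟩
  have h2 : ((Finset.range p).filter fun l => g l ≤ f i) ⊆ Finset.range i := fun l hl => by
    simp only [Finset.mem_range, Finset.mem_filter] at hl ⊢
    by_contra! hle
    have := hg hle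
    omega
  have h1 := Finset.card_le_card h1
  have h2 := Finset.card_le_card h2
  rw [card_filter_le_eq_sum, Finset.sum_congr rfl fun l _ => h l, ← card_filter_le_eq_sum] at h1
  rw [Finset.card_range] at h1 h2
  omega

theorem rowLabel_eq_of_blockSize_eq {G H : BipartiteOrderedGraph} (hl : G.left = H.left)
    (h : ∀ k, G.blockSize k = H.blockSize k) {i : ℕ} (hi : i < G.left) :
    G.rowLabel i = H.rowLabel i := by
  have h' : ∀ k, ((Finset.range G.left).filter fun i => G.rowLabel i = k).card =
      ((Finset.range G.left).filter fun i => H.rowLabel i = k).card := fun k => by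
    have := h k
    rwa [blockSize, blockSize, ← hl] at this
  exact le_antisymm (le_of_card_fibers_eq H.rowLabel_mono G.rowLabel_mono (fun k => (h' k).symm) hi)
    (le_of_card_fibers_eq G.rowLabel_mono H.rowLabel_mono h' hi)

/-- All row labels are less than `K`. -/
def RowBounded (K : ℕ) (G : BipartiteOrderedGraph) : Prop := ∀ i < G.left, G.rowLabel i < K

theorem RowBounded.blockSize_eq_zero {K : ℕ} {G : BipartiteOrderedGraph} (hG : G.RowBounded K)
    {k : ℕ} (hk : K ≤ k) : G.blockSize k = 0 := by
  by_contra h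
  obtain ⟨i, hi, rfl⟩ := blockSize_pos_iff.mp (Nat.pos_of_ne_zero h)
  exact absurd (hG i hi) hk.not_gt

theorem RowBounded.sum_blockSize {K : ℕ} {G : BipartiteOrderedGraph} (hG : G.RowBounded K) :
    ∑ k : Fin K, G.blockSize k = G.left := by
  rw [← Finset.sum_range fun k => G.blockSize k]
  conv_rhs => rw [← Finset.card_range G.left]
  exact (Finset.card_eq_sum_card_fiberwise fun i hi => by
    simpa using hG i (by simpa using hi)).symm

/-- The sizes of the blocks of rows and of columns. -/
noncomputable def sizes (K : ℕ) (G : BipartiteOrderedGraph) : Fin (K + K) → ℕ :=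
  Fin.append (fun k : Fin K => G.blockSize k) fun k : Fin K => G.transpose.blockSize k

open Classical in
/-- The matrix of the values on the blocks. -/
noncomputable def type (K : ℕ) (G : BipartiteOrderedGraph) (k l : Fin K) : Bool :=
  decide (∃ i < G.left, ∃ j < G.right, G.rowLabel i = k ∧ G.transpose.rowLabel j = l ∧
    G.mat i j = true)

theorem type_rowLabel {K : ℕ} {G : BipartiteOrderedGraph} {k l : Fin K} {i j : ℕ} (hi : i < G.left)
    (hj : j < G.right) (hk : G.rowLabel i = k) (hl : G.transpose.rowLabel j = l) :
    type K G k l = G.mat i j := by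
  rw [Bool.eq_iff_iff, type, decide_eq_true_eq]
  constructor
  · rintro ⟨i', hi', j', hj', h1, h2, h3⟩
    rw [← h3]
    exact G.mat_eq_of_labels_eq hi' hj hj' (hk.trans h1.symm) (hl.trans h2.symm)
  · exact fun h => ⟨i, hi, j, hj, hk, hl, h⟩

theorem type_restrict {K : ℕ} {G : BipartiteOrderedGraph} {S T : Finset ℕ}
    (hS : G.MeetsRowBlocks S) (hT : G.transpose.MeetsRowBlocks T) :
    type K (G.restrict S T) = type K G := by
  funext k l
  rw [Bool.eq_iff_iff, type, type, decide_eq_true_eq, decide_eq_true_eq,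
    transpose_restrict G hS.1 hT.1]
  have hSl : ∀ {i}, i < S.card → enum S i < G.left := fun hi =>
    Finset.mem_range.mp (hS.1 (enum_mem hi))
  have hTr : ∀ {i}, i < T.card → enum T i < G.right := fun hi =>
    Finset.mem_range.mp (hT.1 (enum_mem hi))
  have hS' : G.transpose.transpose.MeetsRowBlocks S := by rwa [transpose_transpose]
  constructor
  · rintro ⟨i, hi, j, hj, h1, h2, h3⟩
    rw [rowLabel_restrict hS hT hi] at h1
    rw [rowLabel_restrict hT hS' hj] at h2
    rw [mat_restrict G hi hj] at h3
    exact ⟨_, hSl hi, _, hTr hj, h1, h2, h3⟩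
  · rintro ⟨i, hi, j, hj, h1, h2, h3⟩
    obtain ⟨s, hs, hs'⟩ := hS.2 i hi
    obtain ⟨t, ht, ht'⟩ := hT.2 j hj
    refine ⟨s, hs, t, ht, ?_, ?_, ?_⟩
    · rw [rowLabel_restrict hS hT hs, hs', h1]
    · rw [rowLabel_restrict hT hS' ht, ht', h2]
    · rw [mat_restrict G hs ht, G.mat_eq_of_labels_eq hi (hTr ht) hj hs' ht', h3]

/-! ### Counting properties with boundedly many changes. -/

/-- The block sizes of the members of `P` of a given type. -/
def sizesOfType (P : Set BipartiteOrderedGraph) (K : ℕ) (A : Fin K → Fin K → Bool) :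
    Set (Fin (K + K) → ℕ) :=
  {z | ∃ G ∈ P, type K G = A ∧ sizes K G = z}

/-- All members of `P` have fewer than `K` changes of rows and of columns. -/
def Bounded (P : Set BipartiteOrderedGraph) (K : ℕ) : Prop :=
  ∀ G ∈ P, G.RowBounded K ∧ G.transpose.RowBounded K

/-- Deleting vertices without emptying a block merges no blocks and keeps the block values. -/
theorem supportLower_sizesOfType {P : Set BipartiteOrderedGraph} (hP : SubClosed P) {K : ℕ}
    (hK : Bounded P K) (A : Fin K → Fin K → Bool) : SupportLower (sizesOfType P K A) := by
  rintro _ ⟨G, hG, hA, rfl⟩ y hy hy0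
  have key : ∀ (H : BipartiteOrderedGraph) (e : Fin K → Fin (K + K)), H.RowBounded K →
      (∀ k, sizes K G (e k) = H.blockSize k) → ∃ S, H.MeetsRowBlocks S ∧
        ∀ k : Fin K, (S.filter fun i => H.rowLabel i = k).card = y (e k) := by
    intro H e hH he
    obtain ⟨S, h1, h2⟩ := H.exists_meetsRowBlocks
      (x := fun k => if hk : k < K then y (e ⟨k, hk⟩) else 0) (fun k => by
        split_ifs with hk
        · have := hy (e ⟨k, hk⟩)
          rwa [he] at this
        · exact Nat.zero_le _) (fun k hk0 => by
        split_ifs at hk0 with hk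
        · have := hy0 _ hk0
          rwa [he] at this
        · exact hH.blockSize_eq_zero (not_lt.mp hk))
    exact ⟨S, h1, fun k => by rw [h2]; simp⟩
  obtain ⟨S, hS, hSy⟩ := key G (Fin.castAdd K) (hK G hG).1 fun k => by simp [sizes]
  obtain ⟨T, hT, hTy⟩ := key G.transpose (Fin.natAdd K) (hK G hG).2 fun k => by
    rw [sizes, Fin.append_right]
  refine ⟨G.restrict S T, hP.restrict_mem hG hS.1 hT.1, (type_restrict hS hT).trans hA, ?_⟩
  have hS' : G.transpose.transpose.MeetsRowBlocks S := by rwa [transpose_transpose]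
  funext i
  refine Fin.addCases (fun k => ?_) (fun k => ?_) i
  · rw [sizes, Fin.append_left, blockSize_restrict hS hT, hSy]
  · rw [sizes, Fin.append_right, transpose_restrict G hS.1 hT.1, blockSize_restrict hT hS', hTy]

/-- Block sizes determine the labels of rows and columns, and the type turns labels into entries. -/
theorem Bounded.eq_of_type_eq_of_sizes_eq {P : Set BipartiteOrderedGraph} {K : ℕ}
    (hK : Bounded P K) {G H : BipartiteOrderedGraph} (hG : G ∈ P) (hH : H ∈ P)
    (ht : type K G = type K H) (hs : sizes K G = sizes K H) : G = H := by
  obtain ⟨hG1, hG2⟩ := hK G hG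
  obtain ⟨hH1, hH2⟩ := hK H hH
  have h1 : ∀ k : Fin K, G.blockSize k = H.blockSize k := fun k => by
    simpa [sizes] using congrFun hs (Fin.castAdd K k)
  have h2 : ∀ k : Fin K, G.transpose.blockSize k = H.transpose.blockSize k := fun k => by
    have := congrFun hs (Fin.natAdd K k)
    rwa [sizes, sizes, Fin.append_right, Fin.append_right] at this
  have hl : G.left = H.left := by
    rw [← hG1.sum_blockSize, ← hH1.sum_blockSize, Finset.sum_congr rfl fun k _ => h1 k]
  have hr : G.right = H.right := by
    have := hG2.sum_blockSize
    rw [Finset.sum_congr rfl fun k _ => h2 k, hH2.sum_blockSize] at this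
    exact this.symm
  have h1' : ∀ k, G.blockSize k = H.blockSize k := fun k => by
    rcases lt_or_ge k K with hk | hk
    · exact h1 ⟨k, hk⟩
    · rw [hG1.blockSize_eq_zero hk, hH1.blockSize_eq_zero hk]
  have h2' : ∀ k, G.transpose.blockSize k = H.transpose.blockSize k := fun k => by
    rcases lt_or_ge k K with hk | hk
    · exact h2 ⟨k, hk⟩
    · rw [hG2.blockSize_eq_zero hk, hH2.blockSize_eq_zero hk]
  refine ext_mat hl hr fun i hi j hj => ?_
  have e1 := rowLabel_eq_of_blockSize_eq hl h1' hi
  have e2 := rowLabel_eq_of_blockSize_eq (G := G.transpose) (H := H.transpose) hr h2' hj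
  rw [← type_rowLabel (K := K) (k := ⟨_, hG1 i hi⟩) (l := ⟨_, hG2 j hj⟩) hi hj rfl rfl, ht,
    type_rowLabel (hl ▸ hi) (hr ▸ hj) e1.symm e2.symm]

theorem Bounded.speed_eq_sum {P : Set BipartiteOrderedGraph} {K : ℕ} (hK : Bounded P K) (n : ℕ) :
    speed P n = ∑ A : Fin K → Fin K → Bool, sumCount (sizesOfType P K A) n := by
  classical
  have hsum : ∀ G ∈ P, ∑ i, sizes K G i = G.order := fun G hG => by
    obtain ⟨h1, h2⟩ := hK G hG
    rw [Fin.sum_univ_add, order]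
    simp only [sizes, Fin.append_left, Fin.append_right]
    rw [h1.sum_blockSize, h2.sum_blockSize, left_transpose]
  simp only [sumCount]
  rw [speed, Set.ncard_eq_toFinset_card _ (finite_ofOrder P n), ← Finset.card_sigma]
  refine Finset.card_bij (fun G _ => ⟨type K G, sizes K G⟩) ?_ ?_ ?_
  · intro G hG
    rw [Set.Finite.mem_toFinset] at hG
    simp only [Finset.mem_sigma, Finset.mem_univ, Finset.mem_filter,
      Finset.Nat.mem_antidiagonalTuple, true_and]
    exact ⟨by rw [hsum G hG.1, hG.2], G, hG.1, rfl, rfl⟩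
  · intro G hG H hH h
    rw [Set.Finite.mem_toFinset] at hG hH
    simp only [Sigma.mk.injEq, heq_eq_eq] at h
    exact hK.eq_of_type_eq_of_sizes_eq hG.1 hH.1 h.1 h.2
  · rintro ⟨A, z⟩ hz
    simp only [Finset.mem_sigma, Finset.mem_univ, Finset.mem_filter,
      Finset.Nat.mem_antidiagonalTuple, true_and] at hz
    obtain ⟨hz, G, hG, rfl, rfl⟩ := hz
    refine ⟨G, ?_, rfl⟩
    rw [Set.Finite.mem_toFinset]
    exact ⟨hG, by rw [← hsum G hG, hz]⟩

theorem Bounded.speed_mem_eventuallyPoly {P : Set BipartiteOrderedGraph} (hP : SubClosed P) {K : ℕ}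
    (hK : Bounded P K) : (fun n => (speed P n : ℤ)) ∈ eventuallyPoly := by
  have := eventuallyPoly.sum_mem (t := (Finset.univ : Finset (Fin K → Fin K → Bool)))
    fun A _ => (supportLower_sizesOfType hP hK A).sumCount_mem
  convert this using 1
  ext n
  rw [hK.speed_eq_sum, Finset.sum_apply]
  push_cast
  rfl

theorem exists_changes_of_not_rowBounded {G : BipartiteOrderedGraph} {K : ℕ}
    (h : ¬ G.RowBounded K) :
    ∃ S : Finset ℕ, K ≤ S.card ∧ ∀ k ∈ S, k + 1 < G.left ∧ G.RowChange k := by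
  classical
  simp only [RowBounded, not_forall, not_lt] at h
  obtain ⟨i, hi, h⟩ := h
  rw [rowLabel, Nat.count_eq_card_filter_range] at h
  refine ⟨_, h, fun k hk => ?_⟩
  rw [Finset.mem_filter, Finset.mem_range] at hk
  exact ⟨by omega, hk.2⟩

end BipartiteOrderedGraph

/-! ### The dichotomy. -/

open BipartiteOrderedGraph in
theorem mainTheorem10 (P : Set BipartiteOrderedGraph)
    (hP : BipartiteOrderedGraph.IsHereditary P) :
    (∃ (k : ℕ) (a : Fin (k + 1) → ℤ), ∃ N : ℕ, ∀ n : ℕ, N ≤ n →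
      (BipartiteOrderedGraph.speed P n : ℤ) = ∑ i : Fin (k + 1), a i * (n.choose (i : ℕ) : ℤ)) ∨
    (∀ n : ℕ, 1 ≤ n → 2 ^ (n - 1) ≤ BipartiteOrderedGraph.speed P n) := by
  have hP := hP.subClosed
  by_cases h1 : ∃ K, ∀ G ∈ P, G.RowBounded K
  swap
  · push Not at h1
    refine Or.inr (two_pow_le_speed_of_unbounded hP fun K => ?_)
    obtain ⟨G, hG, h⟩ := h1 K
    exact ⟨G, hG, exists_changes_of_not_rowBounded h⟩
  by_cases h2 : ∃ K, ∀ G ∈ P, G.transpose.RowBounded K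
  swap
  · push Not at h2
    refine Or.inr fun n hn => ?_
    rw [← speed_transpose]
    refine two_pow_le_speed_of_unbounded hP.transpose (fun K => ?_) n hn
    obtain ⟨G, hG, h⟩ := h2 K
    refine ⟨G.transpose, ?_, exists_changes_of_not_rowBounded h⟩
    rwa [Set.mem_preimage, transpose_transpose]
  obtain ⟨K, hK⟩ := h1
  obtain ⟨L, hL⟩ := h2
  -- `type` and `sizes` use one bound for rows and columns alike, hence the maximum.
  refine Or.inl (exists_eq_sum_choose (Bounded.speed_mem_eventuallyPoly hP (K := max K L) ?_))
  exact fun G hG => ⟨fun i hi => lt_max_of_lt_left (hK G hG i hi),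
    fun i hi => lt_max_of_lt_right (hL G hG i hi)⟩
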